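/- Let $(M,d)$ be a compact metric space and let $X=M^{\mathbb Z}$ carry the product topology and its Borel $\sigma$-algebra; assume that $X$ has no isolated points (this holds in particular if $M$ is perfect). Let $T:X\to X$, $(Tx)_i=x_{i-1}$, be the full shift, and let $\mathcal M(T)$ be the space of $T$-invariant Borel probability measures on $X$ with the weak topology. Let $(a_k)_{k\ge 0}$ be a monotone increasing sequence of real numbers with $a_k>-1$ for all $k$, $\sum_{k\ge 0}\frac1{a_k+1}<\infty$, and $\lim_{k\to\infty}a_k e^{-\alpha k}=0$ for each $\alpha>0$, and endow $X$ with the metric $$r(x,y)=\sum_{n\in\mathbb Z}\min\Big\{\frac1{a_{|n|}+1},\,d(x_n,y_n)\Big\}.$$ For a Borel probability measure $\mu$ on $X$, $q>1$ and $\varepsilon\in(0,1)$, put $$I_\mu(q,\varepsilon)=\int_{\operatorname{supp}\mu}\mu(B(x,\varepsilon))^{q-1}\,d\mu(x),\qquad D^+_\mu(q)=\limsup_{\varepsilon\downarrow0}\frac{\log I_\mu(q,\varepsilon)}{(q-1)\log\varepsilon}\in[0,+\infty],$$ where $B(x,\varepsilon)=\{y\in X: r(x,y)<\varepsilon\}$.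 Then, for each $q>1$, the set $$CD=\{\mu\in\mathcal M(T)\;:\;D^+_\mu(q)=+\infty\}$$ is a dense $G_\delta$ subset of $\mathcal M(T)$. -/

import Mathlib

open MeasureTheory Filter Topology
open scoped ENNReal

noncomputable section

namespace FullShift

/-- The full shift on `X = M^ℤ`: `(T x) i = x (i - 1)`. -/
def shift {M : Type*} (x : ℤ → M) : ℤ → M := fun i => x (i - 1)

/-- Admissible weights for a sub-exponential metric. The condition `-1 < a k` says that all the
numbers `1 / (a k + 1)` are positive. -/
structure IsSubexponential (a : ℕ → ℝ) : Prop where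
  neg_one_lt : ∀ k, -1 < a k
  monotone : Monotone a
  summable : Summable fun k => 1 / (a k + 1)
  tendsto : ∀ α : ℝ, 0 < α → Tendsto (fun k : ℕ => a k / Real.exp (α * k)) atTop (𝓝 0)

/-- The metric `r(x, y) = ∑_{n ∈ ℤ} min {1 / (a_{|n|} + 1), d(x_n, y_n)}` on `M^ℤ`. -/
def subexpDist {M : Type*} [MetricSpace M] (a : ℕ → ℝ) (x y : ℤ → M) : ℝ :=
  ∑' n : ℤ, min (1 / (a n.natAbs + 1)) (dist (x n) (y n))

/-- The energy function `I_μ(q, ε) = ∫_{supp μ} μ(B(x, ε))^(q-1) dμ(x)`, where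
`B(x, ε) = {y | r x y < ε}` is the open ball of the metric `r`. -/
def energy {X : Type*} [TopologicalSpace X] [MeasurableSpace X] (r : X → X → ℝ)
    (μ : Measure X) (q ε : ℝ) : ℝ≥0∞ :=
  ∫⁻ x in μ.support, μ {y | r x y < ε} ^ (q - 1) ∂μ

/-- The upper `q`-generalized fractal dimension (`q ≠ 1`) of `μ` with respect to the metric `r`:
`D⁺_μ(q) = limsup_{ε ↓ 0} log I_μ(q, ε) / ((q - 1) log ε)`, in the extended reals. -/
def upperGenDim {X : Type*} [TopologicalSpace X] [MeasurableSpace X] (r : X → X → ℝ)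
    (μ : Measure X) (q : ℝ) : EReal :=
  limsup (fun ε : ℝ => ENNReal.log (energy r μ q ε) / (((q - 1) * Real.log ε : ℝ) : EReal))
    (𝓝[>] 0)

/-- The set `𝓜(T)` of shift-invariant Borel probability measures on `M^ℤ`; as a type, it carries
the subspace topology of the weak topology. -/
def invariantMeasures (M : Type*) [MeasurableSpace M] : Set (ProbabilityMeasure (ℤ → M)) :=
  {μ | MeasurePreserving shift (μ : Measure (ℤ → M)) (μ : Measure (ℤ → M))}

/-- If the alphabet `M` is perfect, then so is `M^ℤ`. -/
theorem perfectSpace_of_alphabet {M : Type*} [TopologicalSpace M] [PerfectSpace M] :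
    PerfectSpace (ℤ → M) := by
  rw [perfectSpace_iff_forall_not_isolated]
  intro x
  have h : Tendsto (fun m => Function.update x 0 m) (𝓝[≠] (x 0)) (𝓝[≠] x) := by
    refine tendsto_nhdsWithin_iff.2 ⟨?_, ?_⟩
    · have hc : Continuous fun m => Function.update x 0 m := by fun_prop
      have := (hc.tendsto (x 0)).mono_left (nhdsWithin_le_nhds (s := {x 0}ᶜ))
      rwa [Function.update_eq_self] at this
    · filter_upwards [self_mem_nhdsWithin] with m hm he
      exact hm (by simpa using congrFun he 0)
  exact h.neBot

end FullShift

end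

open MeasureTheory Filter Topology
open scoped ENNReal

noncomputable section

/-! For the `G_δ` property: the dimension is infinite iff for every `n` some `ε < 1/(n+1)` has
energy below `ε ^ n`. Ball indicators are not weakly continuous in the measure, but a continuous
cutoff gives a `smoothEnergy` that is, and it lies between the energies at `ε` and `2ε`. This
presents the set as a countable intersection of open sets.

For density, an invariant `μ` is perturbed by independent i.i.d. noise that overwrites a coordinate
by `p` or `p'` when its label is `k` or `k + 1`. Invariance survives. A small ball of radius at most
`1/(a N + 1)` pins down `N` coordinates, none of which can take both values, so its mass is at most
`(1 - δ) ^ N` (`perturbMeasure_le`). As `a` is subexponential, this beats every power of `1/(a N +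
1)`. As `k → ∞` each coordinate is eventually untouched, so the laws tend to `μ`. -/

namespace FullShift

/-! ### Weakly continuous approximation of the energy -/

section SmoothEnergy

variable {X : Type*} [TopologicalSpace X] [CompactSpace X] [MeasurableSpace X] [BorelSpace X]

theorem integrable_of_continuous {f : X → ℝ} (hf : Continuous f) (μ : Measure X)
    [IsFiniteMeasure μ] : Integrable f μ :=
  (BoundedContinuousFunction.mkOfCompact ⟨f, hf⟩).integrable μ

/-- Integrals of jointly continuous families against weakly continuous families of probability
measures on a compact space depend continuously on the parameter. -/
theorem continuous_integral_probabilityMeasure {Y : Type*} [TopologicalSpace Y]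
    {m : Y → ProbabilityMeasure X} (hm : Continuous m) {f : Y → X → ℝ}
    (hf : Continuous (Function.uncurry f)) :
    Continuous fun y => ∫ x, f y x ∂(m y : Measure X) := by
  let F : Y → C(X, ℝ) := fun y => ⟨f y, hf.comp (by fun_prop : Continuous fun x => (y, x))⟩
  have hF : Continuous F := ContinuousMap.continuous_of_continuous_uncurry F hf
  rw [continuous_iff_continuousAt]
  intro y₀
  have h₁ : Tendsto (fun y => ∫ x, f y₀ x ∂(m y : Measure X)) (𝓝 y₀)
      (𝓝 (∫ x, f y₀ x ∂(m y₀ : Measure X))) :=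
    (ProbabilityMeasure.tendsto_iff_forall_integral_tendsto.1 (hm.tendsto y₀))
      (BoundedContinuousFunction.mkOfCompact (F y₀))
  -- Compactness makes `y ↦ f y` continuous in sup norm, a bound uniform over all probability
  -- measures.
  have h₂ : Tendsto (fun y => ∫ x, f y x ∂(m y : Measure X) - ∫ x, f y₀ x ∂(m y : Measure X))
      (𝓝 y₀) (𝓝 0) := by
    refine squeeze_zero_norm (a := fun y => ‖F y - F y₀‖) (fun y => ?_) ?_
    · rw [← integral_sub (f := f y) (g := f y₀) (integrable_of_continuous (F y).continuous _)
        (integrable_of_continuous (F y₀).continuous _)]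
      refine (norm_integral_le_of_norm_le_const (C := ‖F y - F y₀‖)
        (Eventually.of_forall fun x => (F y - F y₀).norm_coe_le_norm x)).trans ?_
      simp
    · simpa using ((hF.sub (continuous_const (y := F y₀))).norm).tendsto y₀
  simpa [ContinuousAt] using h₂.add h₁

/-- A continuous cutoff, equal to `1` for `t ≤ ε` and to `0` for `2 * ε ≤ t`. -/
def cutoff (ε t : ℝ) : ℝ := max 0 (min 1 (2 - t / ε))

theorem continuous_cutoff (ε : ℝ) : Continuous (cutoff ε) := by
  unfold cutoff; fun_prop

theorem cutoff_nonneg (ε t : ℝ) : 0 ≤ cutoff ε t := le_max_left _ _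

theorem cutoff_le_one (ε t : ℝ) : cutoff ε t ≤ 1 := max_le zero_le_one (min_le_left _ _)

theorem cutoff_eq_one {ε t : ℝ} (hε : 0 < ε) (ht : t ≤ ε) : cutoff ε t = 1 := by
  have : t / ε ≤ 1 := (div_le_one hε).2 ht
  rw [cutoff, min_eq_left (by linarith), max_eq_right zero_le_one]

theorem cutoff_eq_zero {ε t : ℝ} (hε : 0 < ε) (ht : 2 * ε ≤ t) : cutoff ε t = 0 := by
  have : 2 ≤ t / ε := (le_div_iff₀ hε).2 ht
  exact max_eq_left ((min_le_right _ _).trans (by linarith))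

/-- The energy function with the indicator of the ball replaced by a continuous cutoff. -/
def smoothEnergy (r : X → X → ℝ) (μ : Measure X) (q ε : ℝ) : ℝ :=
  ∫ x, (∫ y, cutoff ε (r x y) ∂μ) ^ (q - 1) ∂μ

variable {r : X → X → ℝ} {q ε : ℝ}

theorem continuous_smoothEnergy
    (hr : Continuous (Function.uncurry r)) (hq : 1 < q) :
    Continuous fun μ : ProbabilityMeasure X => smoothEnergy r (μ : Measure X) q ε := by
  refine continuous_integral_probabilityMeasure
    (f := fun (μ : ProbabilityMeasure X) x => (∫ y, cutoff ε (r x y) ∂(μ : Measure X)) ^ (q - 1))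
    continuous_id ?_
  refine Continuous.rpow_const ?_ fun _ => Or.inr (by linarith)
  refine continuous_integral_probabilityMeasure
    (f := fun (z : ProbabilityMeasure X × X) y => cutoff ε (r z.2 y)) continuous_fst ?_
  exact (continuous_cutoff ε).comp
    (hr.comp (by fun_prop : Continuous fun z : (ProbabilityMeasure X × X) × X => (z.1.2, z.2)))

theorem ofReal_smoothEnergy
    (hr : Continuous (Function.uncurry r)) (μ : ProbabilityMeasure X) (hq : 1 < q) :
    ENNReal.ofReal (smoothEnergy r (μ : Measure X) q ε) =
      ∫⁻ x, (∫⁻ y, ENNReal.ofReal (cutoff ε (r x y)) ∂(μ : Measure X)) ^ (q - 1)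
        ∂(μ : Measure X) := by
  have hc : Continuous fun z : X × X => cutoff ε (r z.1 z.2) := (continuous_cutoff ε).comp hr
  have hi : Continuous fun x => ∫ y, cutoff ε (r x y) ∂(μ : Measure X) :=
    continuous_integral_probabilityMeasure (m := fun _ : X => μ) continuous_const hc
  have h0 : ∀ x, 0 ≤ ∫ y, cutoff ε (r x y) ∂(μ : Measure X) :=
    fun x => integral_nonneg fun y => cutoff_nonneg _ _
  rw [smoothEnergy, ofReal_integral_eq_lintegral_ofReal]
  · refine lintegral_congr fun x => ?_
    rw [← ENNReal.ofReal_rpow_of_nonneg (h0 x) (by linarith), ofReal_integral_eq_lintegral_ofReal]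
    · exact integrable_of_continuous (hc.comp (by fun_prop : Continuous fun y => (x, y))) _
    · exact Eventually.of_forall fun y => cutoff_nonneg _ _
  · exact integrable_of_continuous (hi.rpow_const fun _ => Or.inr (by linarith)) _
  · exact Eventually.of_forall fun x => Real.rpow_nonneg (h0 x) _

theorem energy_le_ofReal_smoothEnergy
    (hr : Continuous (Function.uncurry r)) (μ : ProbabilityMeasure X) (hq : 1 < q) (hε : 0 < ε) :
    energy r (μ : Measure X) q ε ≤ ENNReal.ofReal (smoothEnergy r (μ : Measure X) q ε) := by
  rw [ofReal_smoothEnergy hr μ hq]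
  refine (setLIntegral_le_lintegral _ _).trans (lintegral_mono fun x => ?_)
  refine ENNReal.rpow_le_rpow ?_ (by linarith)
  have hm : MeasurableSet {y | r x y < ε} :=
    (isOpen_lt (hr.comp (by fun_prop : Continuous fun y => (x, y))) continuous_const).measurableSet
  rw [← lintegral_indicator_one hm]
  refine lintegral_mono fun y => ?_
  by_cases hy : r x y < ε
  · simp [Set.indicator, hy, cutoff_eq_one hε hy.le]
  · simp [Set.indicator, hy]

theorem ofReal_smoothEnergy_le_energy [HereditarilyLindelofSpace X]
    (hr : Continuous (Function.uncurry r)) (μ : ProbabilityMeasure X)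
    (hq : 1 < q) (hε : 0 < ε) :
    ENNReal.ofReal (smoothEnergy r (μ : Measure X) q ε) ≤
      energy r (μ : Measure X) q (2 * ε) := by
  -- The support is conull by the hereditary Lindelöf property, so restricting to it changes
  -- nothing.
  rw [ofReal_smoothEnergy hr μ hq, energy,
    setLIntegral_congr (eventuallyEq_univ.2 Measure.support_mem_ae), setLIntegral_univ]
  refine lintegral_mono fun x => ENNReal.rpow_le_rpow ?_ (by linarith)
  have hm : MeasurableSet {y | r x y < 2 * ε} :=
    (isOpen_lt (hr.comp (by fun_prop : Continuous fun y => (x, y))) continuous_const).measurableSet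
  rw [← lintegral_indicator_one hm]
  refine lintegral_mono fun y => ?_
  by_cases hy : r x y < 2 * ε
  · simp [Set.indicator, hy, cutoff_le_one]
  · simp [Set.indicator, hy, cutoff_eq_zero hε (not_lt.1 hy)]

end SmoothEnergy

/-! ### Infinite dimension in terms of energy decay -/

section Dimension

variable {X : Type*} [TopologicalSpace X] [MeasurableSpace X] {r : X → X → ℝ} {μ : Measure X}
  {q : ℝ}

theorem upperGenDim_eq_top_of_energy_le (hq : 1 < q)
    (h : ∀ n : ℕ, ∃ ε : ℝ, 0 < ε ∧ ε < 1 / (n + 1) ∧ energy r μ q ε ≤ ENNReal.ofReal (ε ^ n)) :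
    upperGenDim r μ q = ⊤ := by
  rw [EReal.eq_top_iff_forall_lt]
  intro b
  obtain ⟨m, hm⟩ := exists_nat_gt ((q - 1) * b)
  have hbm : b < m / (q - 1) := by
    rw [lt_div_iff₀ (by linarith)]; linarith
  refine lt_of_lt_of_le (EReal.coe_lt_coe_iff.2 hbm) (le_limsup_of_frequently_le' ?_)
  rw [frequently_iff]
  intro U hU
  obtain ⟨δ, hδ, hδU⟩ := mem_nhdsGT_iff_exists_Ioo_subset.1 hU
  obtain ⟨n₁, hn₁⟩ := exists_nat_one_div_lt (Set.mem_Ioi.1 hδ)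
  -- `m` secures the decay exponent, `n₁` the membership in `U`.
  obtain ⟨ε, hε0, hε, hI⟩ := h (max (max m n₁) 1)
  have hcast : ∀ k : ℕ, k ≤ max (max m n₁) 1 →
      1 / ((max (max m n₁) 1 : ℕ) + 1 : ℝ) ≤ 1 / (k + 1) := fun k hk => by
    have : (k : ℝ) ≤ (max (max m n₁) 1 : ℕ) := by exact_mod_cast hk
    gcongr
  have hε1 : ε < 1 := (hε.trans_le (hcast 0 (Nat.zero_le _))).trans_le (by norm_num)
  have hlog : Real.log ε < 0 := Real.log_neg hε0 hε1
  refine ⟨ε, hδU ⟨hε0, (hε.trans_le (hcast n₁ (by simp))).trans hn₁⟩, ?_⟩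
  have hI' : energy r μ q ε ≤ ENNReal.ofReal (ε ^ m) :=
    hI.trans (ENNReal.ofReal_le_ofReal (pow_le_pow_of_le_one hε0.le hε1.le (by simp)))
  have hl := ENNReal.log_le_log hI'
  rw [ENNReal.log_ofReal_of_pos (by positivity), Real.log_pow] at hl
  have hneg : (q - 1) * Real.log ε < 0 := mul_neg_of_pos_of_neg (by linarith) hlog
  refine le_trans (le_of_eq ?_) (EReal.div_le_div_right_of_nonpos
    (EReal.coe_nonpos.2 hneg.le) hl)
  rw [← EReal.coe_div, EReal.coe_eq_coe_iff, mul_div_mul_right _ _ hlog.ne]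

theorem exists_energy_le_of_upperGenDim_eq_top (hq : 1 < q) (h : upperGenDim r μ q = ⊤)
    (n : ℕ) {δ : ℝ} (hδ : 0 < δ) :
    ∃ ε : ℝ, 0 < ε ∧ ε < δ ∧ energy r μ q ε ≤ ENNReal.ofReal (ε ^ n) := by
  have hlt : ((n / (q - 1) : ℝ) : EReal) < upperGenDim r μ q := h ▸ EReal.coe_lt_top _
  have hf := (frequently_lt_of_lt_limsup (by isBoundedDefault) hlt).and_eventually
    (Ioo_mem_nhdsGT (lt_min hδ one_pos))
  obtain ⟨ε, hlt, hε0, hε⟩ := hf.exists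
  have hlog : Real.log ε < 0 := Real.log_neg hε0 (hε.trans_le (min_le_right _ _))
  have hneg : (q - 1) * Real.log ε < 0 := mul_neg_of_pos_of_neg (by linarith) hlog
  refine ⟨ε, hε0, hε.trans_le (min_le_left _ _), ?_⟩
  by_contra! hI
  have hl := ENNReal.log_le_log hI.le
  rw [ENNReal.log_ofReal_of_pos (by positivity), Real.log_pow] at hl
  refine hlt.not_ge ((EReal.div_le_div_right_of_nonpos
    (EReal.coe_nonpos.2 hneg.le) hl).trans (le_of_eq ?_))
  rw [← EReal.coe_div, EReal.coe_eq_coe_iff, mul_div_mul_right _ _ hlog.ne]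

end Dimension

/-! ### The `G_δ` property -/

theorem upperGenDim_eq_top_iff {X : Type*} [TopologicalSpace X] [CompactSpace X]
    [HereditarilyLindelofSpace X] [MeasurableSpace X] [BorelSpace X] {r : X → X → ℝ}
    (hr : Continuous (Function.uncurry r)) {q : ℝ} (hq : 1 < q) (μ : ProbabilityMeasure X) :
    upperGenDim r (μ : Measure X) q = ⊤ ↔
      ∀ n : ℕ, ∃ ε : ℝ, 0 < ε ∧ ε < 1 / (n + 1) ∧ smoothEnergy r (μ : Measure X) q ε < ε ^ n := by
  constructor
  · intro h n
    have hδ : (0 : ℝ) < 1 / (n + 1) := by positivity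
    -- The radius will be halved: for `ε < 1/2`, `ε² ≤ ε/2` absorbs the loss, and the spare factor
    -- `ε` makes the inequality strict.
    obtain ⟨ε, hε0, hε, hI⟩ := exists_energy_le_of_upperGenDim_eq_top hq h (2 * n + 1)
      (lt_min hδ (by norm_num : (0 : ℝ) < 1 / 2))
    have hε2 := hε.trans_le (min_le_right _ _)
    refine ⟨ε / 2, by positivity, by linarith [hε.trans_le (min_le_left _ _)], ?_⟩
    have hJ := ofReal_smoothEnergy_le_energy hr μ hq (half_pos hε0)
    rw [mul_div_cancel₀ _ two_ne_zero] at hJ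
    refine ((ENNReal.ofReal_le_ofReal_iff (by positivity)).1 (hJ.trans hI)).trans_lt ?_
    calc ε ^ (2 * n + 1) = (ε * ε) ^ n * ε := by ring
      _ < (ε * ε) ^ n * 1 := by gcongr; linarith
      _ ≤ (ε / 2) ^ n := by rw [mul_one]; gcongr; nlinarith
  · intro h
    refine upperGenDim_eq_top_of_energy_le hq fun n => ?_
    obtain ⟨ε, hε0, hε, hJ⟩ := h n
    exact ⟨ε, hε0, hε, (energy_le_ofReal_smoothEnergy hr μ hq hε0).trans
      (ENNReal.ofReal_le_ofReal hJ.le)⟩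

theorem isGδ_setOf_upperGenDim_eq_top {X : Type*} [TopologicalSpace X] [CompactSpace X]
    [HereditarilyLindelofSpace X] [MeasurableSpace X] [BorelSpace X] {r : X → X → ℝ}
    (hr : Continuous (Function.uncurry r)) {q : ℝ} (hq : 1 < q) :
    IsGδ {μ : ProbabilityMeasure X | upperGenDim r (μ : Measure X) q = ⊤} := by
  have : {μ : ProbabilityMeasure X | upperGenDim r (μ : Measure X) q = ⊤} =
      ⋂ n : ℕ, ⋃ ε ∈ Set.Ioo (0 : ℝ) (1 / (n + 1)),
        {μ : ProbabilityMeasure X | smoothEnergy r (μ : Measure X) q ε < ε ^ n} := by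
    ext μ
    simp [upperGenDim_eq_top_iff hr hq, and_assoc]
  rw [this]
  exact IsGδ.iInter_of_isOpen fun n => isOpen_biUnion fun ε _ =>
    isOpen_lt (continuous_smoothEnergy hr hq) continuous_const

/-! ### Balls of the subexponential metric -/

section Metric

variable {M : Type*} [MetricSpace M] {a : ℕ → ℝ}

theorem IsSubexponential.weight_pos (ha : IsSubexponential a) (k : ℕ) : 0 < 1 / (a k + 1) := by
  have := ha.neg_one_lt k
  exact one_div_pos.2 (by linarith)

theorem IsSubexponential.weight_antitone (ha : IsSubexponential a) :
    Antitone fun k => 1 / (a k + 1) := fun k l hkl => by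
  have := ha.neg_one_lt k
  exact one_div_le_one_div_of_le (by linarith) (by linarith [ha.monotone hkl])

theorem IsSubexponential.summable_int (ha : IsSubexponential a) :
    Summable fun n : ℤ => 1 / (a n.natAbs + 1) :=
  Summable.of_nat_of_neg (by simpa using ha.summable) (by simpa using ha.summable)

theorem norm_min_weight_le (ha : IsSubexponential a) (x y : ℤ → M) (n : ℤ) :
    ‖min (1 / (a n.natAbs + 1)) (dist (x n) (y n))‖ ≤ 1 / (a n.natAbs + 1) := by
  rw [Real.norm_of_nonneg (le_min (ha.weight_pos _).le dist_nonneg)]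
  exact min_le_left _ _

theorem continuous_subexpDist (ha : IsSubexponential a) :
    Continuous (Function.uncurry (subexpDist (M := M) a)) := by
  refine continuous_tsum (fun n => ?_) ha.summable_int fun n z => norm_min_weight_le ha z.1 z.2 n
  fun_prop

/-- For `|n| ≤ N` the truncation level is at least `ε`, so a term below `ε` must be the distance
itself. -/
theorem dist_lt_of_subexpDist_lt (ha : IsSubexponential a) {x y : ℤ → M} {N : ℕ} {ε : ℝ}
    (hε : ε ≤ 1 / (a N + 1))
    (h : subexpDist a x y < ε) {n : ℤ} (hn : n.natAbs ≤ N) : dist (x n) (y n) < ε := by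
  have hle : min (1 / (a n.natAbs + 1)) (dist (x n) (y n)) ≤ subexpDist a x y :=
    (Summable.of_norm_bounded ha.summable_int (norm_min_weight_le ha x y)).le_tsum n
      fun m _ => le_min (ha.weight_pos _).le dist_nonneg
  rcases min_lt_iff.1 (hle.trans_lt h) with h' | h'
  · exact absurd (h'.trans_le (hε.trans (ha.weight_antitone hn))) (lt_irrefl _)
  · exact h'

/-- Exponentially small quantities are eventually smaller than any power of the weights. -/
theorem IsSubexponential.eventually_exp_le_weight_pow (ha : IsSubexponential a)
    {α : ℝ} (hα : 0 < α) (n : ℕ) :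
    ∀ᶠ N : ℕ in atTop, Real.exp (-(α * N)) ≤ (1 / (a N + 1)) ^ n := by
  -- Any rate `β > 0` with `n * β ≤ α` works; dividing by `n + 1` also covers `n = 0`.
  have hβ : 0 < α / (n + 1) := by positivity
  have h₁ := ha.tendsto _ hβ
  have h₂ : Tendsto (fun N : ℕ => 1 / Real.exp (α / (n + 1) * N)) atTop (𝓝 0) := by
    simp_rw [one_div]
    exact (Real.tendsto_exp_atTop.comp
      (tendsto_natCast_atTop_atTop.const_mul_atTop hβ)).inv_tendsto_atTop
  have h₃ := h₁.add h₂
  rw [add_zero] at h₃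
  filter_upwards [h₃.eventually_lt_const one_pos] with N hN
  rw [← add_div, div_lt_one (Real.exp_pos _)] at hN
  have hpos : 0 < a N + 1 := by linarith [ha.neg_one_lt N]
  calc Real.exp (-(α * N)) ≤ Real.exp (n * (-(α / (n + 1) * N))) := by
        refine Real.exp_le_exp.2 ?_
        have : n * (-(α / (n + 1) * N)) = -(α * N) + α * N / (n + 1) := by field_simp; ring
        rw [this]
        have : 0 ≤ α * N / (n + 1) := by positivity
        linarith
    _ = (1 / Real.exp (α / (n + 1) * N)) ^ n := by
        rw [Real.exp_nat_mul, Real.exp_neg, one_div]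
    _ ≤ (1 / (a N + 1)) ^ n := by gcongr

/-- A measure all of whose small balls have exponentially small measure in the number of
coordinates that they control has infinite upper dimensions. -/
theorem upperGenDim_subexpDist_eq_top (ha : IsSubexponential a) [MeasurableSpace M]
    {μ : Measure (ℤ → M)}
    [IsProbabilityMeasure μ] {q θ c : ℝ} (hq : 1 < q) (hθ₀ : 0 < θ) (hθ₁ : θ < 1) (hc : 0 < c)
    (h : ∀ N : ℕ, ∀ ε ≤ 1 / (a N + 1), ε ≤ c → ∀ x,
      μ {y | subexpDist a x y < ε} ≤ ENNReal.ofReal (θ ^ N)) :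
    upperGenDim (subexpDist a) μ q = ⊤ := by
  refine upperGenDim_eq_top_of_energy_le hq fun n => ?_
  -- With this rate `α`, `exp (-(α * N)) = (θ ^ N) ^ (q - 1)`.
  have hα : 0 < -Real.log θ * (q - 1) :=
    mul_pos (neg_pos.2 (Real.log_neg hθ₀ hθ₁)) (by linarith)
  have hw := ha.summable.tendsto_atTop_zero
  obtain ⟨N, hN, hNn, hNc⟩ := ((ha.eventually_exp_le_weight_pow hα n).and
    ((hw.eventually_lt_const (by positivity : (0 : ℝ) < 1 / (n + 1))).and
      (hw.eventually_lt_const hc))).exists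
  refine ⟨1 / (a N + 1), ha.weight_pos N, hNn, ?_⟩
  calc energy (subexpDist a) μ q (1 / (a N + 1))
      ≤ ∫⁻ _, ENNReal.ofReal (θ ^ N) ^ (q - 1) ∂μ :=
        (setLIntegral_le_lintegral _ _).trans (lintegral_mono fun x =>
          ENNReal.rpow_le_rpow (h N _ le_rfl hNc.le x) (by linarith))
    _ = ENNReal.ofReal ((θ ^ N) ^ (q - 1)) := by
        rw [lintegral_const, measure_univ, mul_one,
          ENNReal.ofReal_rpow_of_nonneg (by positivity) (by linarith)]
    _ ≤ ENNReal.ofReal ((1 / (a N + 1)) ^ n) := by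
        refine ENNReal.ofReal_le_ofReal (le_trans (le_of_eq ?_) hN)
        rw [Real.rpow_def_of_pos (by positivity), Real.log_pow]
        ring_nf

end Metric

/-! ### Perturbation by independent noise -/

section Noise

variable {M : Type*}

/-- Replace the coordinate `x n` by `p` where `u n = k` and by `p'` where `u n = k + 1`. -/
def perturb (p p' : M) (k : ℕ) (z : (ℤ → M) × (ℤ → ℕ)) : ℤ → M :=
  fun n => if z.2 n = k then p else if z.2 n = k + 1 then p' else z.1 n

theorem semiconj_perturb (p p' : M) (k : ℕ) :
    Function.Semiconj (perturb p p' k) (Prod.map shift shift) shift := fun _ => rfl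

theorem tendsto_perturb [TopologicalSpace M] (p p' : M) (z : (ℤ → M) × (ℤ → ℕ)) :
    Tendsto (fun k => perturb p p' k z) atTop (𝓝 z.1) := by
  refine tendsto_pi_nhds.2 fun n => tendsto_nhds_of_eventually_eq ?_
  filter_upwards [eventually_gt_atTop (z.2 n)] with k hk
  rw [perturb, if_neg hk.ne, if_neg (by omega)]

theorem measurable_shift [MeasurableSpace M] : Measurable (shift (M := M)) :=
  measurable_pi_lambda _ fun _ => measurable_pi_apply _

theorem measurable_perturb [MeasurableSpace M] (p p' : M) (k : ℕ) :
    Measurable (perturb p p' k) := by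
  refine measurable_pi_lambda _ fun n => ?_
  have hn : Measurable fun z : (ℤ → M) × (ℤ → ℕ) => z.2 n := by fun_prop
  exact Measurable.ite (hn (measurableSet_singleton k)) measurable_const
    (Measurable.ite (hn (measurableSet_singleton (k + 1))) measurable_const (by fun_prop))

theorem measurePreserving_shift_infinitePi {E : Type*} [MeasurableSpace E] (κ : Measure E)
    [IsProbabilityMeasure κ] :
    MeasurePreserving shift (Measure.infinitePi fun _ : ℤ => κ)
      (Measure.infinitePi fun _ : ℤ => κ) := by
  refine ⟨measurable_shift, ?_⟩
  have h := Measure.infinitePi_map_piCongrLeft (fun _ : ℤ => κ) (Equiv.addRight (1 : ℤ))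
  convert h using 2
  ext u n
  have := MeasurableEquiv.piCongrLeft_apply_apply (β := fun _ : ℤ => E) (Equiv.addRight (1 : ℤ))
    u (n - 1)
  simpa [shift] using this.symm

variable [MeasurableSpace M]

/-- The law of the perturbation of a `μ`-random sequence by independent noise. -/
def perturbMeasure (μ : Measure (ℤ → M)) (κ : Measure ℕ) [IsProbabilityMeasure κ] (p p' : M)
    (k : ℕ) : Measure (ℤ → M) :=
  (μ.prod (Measure.infinitePi fun _ : ℤ => κ)).map (perturb p p' k)

variable (μ : Measure (ℤ → M)) [IsProbabilityMeasure μ] (κ : Measure ℕ) [IsProbabilityMeasure κ]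
  (p p' : M) (k : ℕ)

instance : IsProbabilityMeasure (perturbMeasure μ κ p p' k) :=
  Measure.isProbabilityMeasure_map (measurable_perturb p p' k).aemeasurable

theorem measurePreserving_shift_perturbMeasure (h : MeasurePreserving shift μ μ) :
    MeasurePreserving shift (perturbMeasure μ κ p p' k) (perturbMeasure μ κ p p' k) := by
  refine ⟨measurable_shift, ?_⟩
  rw [perturbMeasure, Measure.map_map measurable_shift (measurable_perturb p p' k),
    ← (semiconj_perturb p p' k).comp_eq, ← Measure.map_map (measurable_perturb p p' k)
      (measurable_shift.prodMap measurable_shift),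
    (h.prod (measurePreserving_shift_infinitePi κ)).map_eq]

/-- If `s` avoids `p` (or `p'`) at `n`, the label `k` (or `k + 1`) is forbidden there, which costs
mass `δ`; independence multiplies these costs. -/
theorem perturbMeasure_le {s : Set (ℤ → M)} (hs : MeasurableSet s) {δ : ℝ≥0∞}
    (hk : δ ≤ κ {k}) (hk' : δ ≤ κ {k + 1}) (F : Finset ℤ)
    (h : ∀ n ∈ F, (∀ y ∈ s, y n ≠ p) ∨ ∀ y ∈ s, y n ≠ p') :
    perturbMeasure μ κ p p' k s ≤ (1 - δ) ^ F.card := by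
  classical
  let t : ℤ → Set ℕ := fun n => if ∀ y ∈ s, y n ≠ p then {k}ᶜ else {k + 1}ᶜ
  have ht : ∀ n, κ (t n) ≤ 1 - δ := fun n => by
    have hc : ∀ j, κ {j}ᶜ = 1 - κ {j} := fun j => prob_compl_eq_one_sub (measurableSet_singleton j)
    by_cases hn : ∀ y ∈ s, y n ≠ p
    · simp only [t, if_pos hn, hc]
      exact tsub_le_tsub_left hk 1
    · simp only [t, if_neg hn, hc]
      exact tsub_le_tsub_left hk' 1
  rw [perturbMeasure, Measure.map_apply (measurable_perturb p p' k) hs,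
    Measure.prod_apply (measurable_perturb p p' k hs)]
  calc _ ≤ ∫⁻ _, (1 - δ) ^ F.card ∂μ := lintegral_mono fun x => ?_
    _ = (1 - δ) ^ F.card := by simp
  -- The bound holds for each fixed `x`, whatever `μ` is.
  calc _ ≤ (Measure.infinitePi fun _ : ℤ => κ) (Set.pi F t) := measure_mono fun u hu n hn => ?_
    _ = ∏ n ∈ F, κ (t n) := Measure.infinitePi_pi _ fun _ _ => MeasurableSet.of_discrete
    _ ≤ (1 - δ) ^ F.card := Finset.prod_le_pow_card _ _ _ fun n _ => ht n
  have hu : perturb p p' k (x, u) ∈ s := hu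
  by_cases hp : ∀ y ∈ s, y n ≠ p
  · simp only [t, if_pos hp]
    exact fun he : u n = k => hp _ hu (by simp [perturb, he])
  · simp only [t, if_neg hp]
    exact fun he : u n = k + 1 => ((h n hn).resolve_left hp) _ hu (by simp [perturb, he])

end Noise

/-! ### Density of infinite dimension -/

section Density

variable {M : Type*} [MetricSpace M] [CompactSpace M] [MeasurableSpace M] [BorelSpace M]

theorem upperGenDim_perturbMeasure {a : ℕ → ℝ} (ha : IsSubexponential a) {q : ℝ} (hq : 1 < q)
    (μ : Measure (ℤ → M)) [IsProbabilityMeasure μ] (κ : Measure ℕ) [IsProbabilityMeasure κ]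
    {p p' : M} (hp : p ≠ p') {k : ℕ} (hk : κ {k} ≠ 0) (hk' : κ {k + 1} ≠ 0) :
    upperGenDim (subexpDist a) (perturbMeasure μ κ p p' k) q = ⊤ := by
  obtain ⟨δ, hδ0, hδ⟩ := exists_between (show (0 : ℝ) < min (min (κ.real {k}) (κ.real {k + 1})) 1 by
    simp [measureReal_def, ENNReal.toReal_pos_iff, pos_iff_ne_zero, hk, hk', lt_top_iff_ne_top])
  obtain ⟨hδk, hδ1⟩ := lt_min_iff.1 hδ
  obtain ⟨hδk, hδk'⟩ := lt_min_iff.1 hδk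
  -- With radius at most `dist p p' / 2`, the triangle inequality prevents a ball from showing `p`
  -- and `p'` at the same controlled coordinate.
  refine upperGenDim_subexpDist_eq_top ha hq (θ := 1 - δ) (c := dist p p' / 2) (by linarith)
    (by linarith) (half_pos (dist_pos.2 hp)) fun N ε hε hεc x => ?_
  have hs : MeasurableSet {y | subexpDist a x y < ε} :=
    (isOpen_lt ((continuous_subexpDist ha).comp (by fun_prop : Continuous fun y => (x, y)))
      continuous_const).measurableSet
  have hle : ∀ j, δ < κ.real {j} → ENNReal.ofReal δ ≤ κ {j} := fun j hj =>
    ENNReal.ofReal_le_of_le_toReal hj.le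
  refine (perturbMeasure_le μ κ p p' k hs (hle k hδk) (hle _ hδk') (Finset.Ico (0 : ℤ) N)
    fun n hn => ?_).trans (le_of_eq ?_)
  · rw [Finset.mem_Ico] at hn
    by_contra! hcon
    obtain ⟨⟨y, hy, rfl⟩, y', hy', rfl⟩ := hcon
    have h₁ := dist_lt_of_subexpDist_lt ha hε hy (n := n) (by omega)
    have h₂ := dist_lt_of_subexpDist_lt ha hε hy' (n := n) (by omega)
    linarith [dist_triangle_left (y n) (y' n) (x n)]
  · rw [ENNReal.ofReal_pow (by linarith), ENNReal.ofReal_sub _ hδ0.le, ENNReal.ofReal_one,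
      Int.card_Ico, sub_zero, Int.toNat_natCast]

/-- All perturbed laws live on one product space, where the perturbed sequences converge pointwise;
dominated convergence applies. -/
theorem tendsto_perturbMeasure (μ : ProbabilityMeasure (ℤ → M)) (κ : Measure ℕ)
    [IsProbabilityMeasure κ] (p p' : M) :
    Tendsto (β := ProbabilityMeasure (ℤ → M))
      (fun k => ⟨perturbMeasure μ κ p p' k, inferInstance⟩) atTop (𝓝 μ) := by
  refine ProbabilityMeasure.tendsto_iff_forall_integral_tendsto.2 fun f => ?_
  change Tendsto (fun k => ∫ x, f x ∂(perturbMeasure (μ : Measure (ℤ → M)) κ p p' k)) _ _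
  have hf : ∀ k, ∫ x, f x ∂(perturbMeasure (μ : Measure (ℤ → M)) κ p p' k) =
      ∫ z, f (perturb p p' k z) ∂((μ : Measure (ℤ → M)).prod (Measure.infinitePi fun _ => κ)) :=
    fun k => integral_map (measurable_perturb p p' k).aemeasurable
      f.continuous.aestronglyMeasurable
  have hμ : ∫ x, f x ∂(μ : Measure (ℤ → M)) =
      ∫ z, f z.1 ∂((μ : Measure (ℤ → M)).prod (Measure.infinitePi fun _ : ℤ => κ)) := by
    rw [integral_fun_fst]; simp
  simp only [hf, hμ]
  refine tendsto_integral_of_dominated_convergence (fun _ => ‖f‖) (fun k => ?_)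
    (integrable_const _) (fun k => Eventually.of_forall fun z => f.norm_coe_le_norm _)
    (Eventually.of_forall fun z => (f.continuous.tendsto _).comp (tendsto_perturb p p' z))
  exact (f.continuous.measurable.comp (measurable_perturb p p' k)).aestronglyMeasurable

theorem dense_setOf_upperGenDim_eq_top [Nontrivial M] {a : ℕ → ℝ} (ha : IsSubexponential a)
    {q : ℝ} (hq : 1 < q) :
    Dense {μ : invariantMeasures M |
      upperGenDim (subexpDist a) (μ.1 : Measure (ℤ → M)) q = ⊤} := by
  intro μ
  obtain ⟨p, p', hp⟩ := exists_pair_ne M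
  -- Any law charging every natural number would do.
  let κ : Measure ℕ := ProbabilityTheory.poissonMeasure 1
  have hκ : ∀ j, κ {j} ≠ 0 := fun j => by
    simp only [κ, ProbabilityTheory.poissonMeasure_singleton]
    exact (ENNReal.ofReal_pos.2 (by simp; positivity)).ne'
  let ν : ℕ → invariantMeasures M := fun k =>
    ⟨⟨perturbMeasure μ.1 κ p p' k, inferInstance⟩,
      measurePreserving_shift_perturbMeasure _ κ p p' k μ.2⟩
  have hν : Tendsto ν atTop (𝓝 μ) :=
    tendsto_subtype_rng.2 (tendsto_perturbMeasure μ.1 κ p p')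
  exact mem_closure_of_tendsto hν (Eventually.of_forall fun k =>
    upperGenDim_perturbMeasure ha hq _ κ hp (hκ k) (hκ (k + 1)))

end Density

theorem nontrivial_alphabet_of_perfectSpace {M : Type*} [TopologicalSpace M]
    [PerfectSpace (ℤ → M)] [Nonempty M] : Nontrivial M := by
  by_contra h
  rw [not_nontrivial_iff_subsingleton] at h
  let x : ℤ → M := fun _ => Classical.arbitrary M
  have := perfectSpace_iff_forall_not_isolated.1 ‹PerfectSpace (ℤ → M)› x
  exact this.ne (by rw [Set.compl_empty_iff.2 (Set.subsingleton_univ.eq_singleton_of_mem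
    (Set.mem_univ x)).symm, nhdsWithin_empty])

end FullShift
end

theorem theorem1p3 {M : Type*} [MetricSpace M] [CompactSpace M] [MeasurableSpace M]
    [BorelSpace M] [PerfectSpace (ℤ → M)] (a : ℕ → ℝ) (ha : FullShift.IsSubexponential a)
    (q : ℝ) (hq : 1 < q) :
    IsGδ {μ : FullShift.invariantMeasures M |
        FullShift.upperGenDim (FullShift.subexpDist a) (μ.1 : Measure (ℤ → M)) q = ⊤} ∧
      Dense {μ : FullShift.invariantMeasures M |
        FullShift.upperGenDim (FullShift.subexpDist a) (μ.1 : Measure (ℤ → M)) q = ⊤} := by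
  constructor
  · exact (FullShift.isGδ_setOf_upperGenDim_eq_top
      (FullShift.continuous_subexpDist ha) hq).preimage continuous_subtype_val
  · cases isEmpty_or_nonempty M with
    | inl h =>
      -- Over an empty alphabet there are no probability measures.
      intro μ
      obtain ⟨x⟩ := μ.1.nonempty
      exact isEmptyElim (x 0)
    | inr h =>
      have := FullShift.nontrivial_alphabet_of_perfectSpace (M := M)
      exact FullShift.dense_setOf_upperGenDim_eq_top ha hq
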